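/- There is an absolute constant $c>0$ such that the following holds. Let $n,p\ge 1$, let $f_1,\dots,f_n:\mathbb{R}^p\to\mathbb{R}$ be twice differentiable, $f=\frac1n\sum_{i=1}^n f_i$, and let $\theta_*$ be a minimizer of $f$ over $\mathbb{R}^p$. For a nonempty finite collection $S$ of indices in $[n]=\{1,\dots,n\}$ (counted with multiplicity) write $\mathbf H_S(\theta)=\frac1{|S|}\sum_{i\in S}\nabla^2 f_i(\theta)$. Let $\mathcal C\subseteq\mathbb{R}^p$ be convex with $\theta_*\in\mathcal C$, and suppose there are constants $M_k$ and $K$ with $$\|\mathbf H_S(\theta)-\mathbf H_S(\theta')\|_2\le M_{|S|}\|\theta-\theta'\|_2\quad\text{for all nonempty } S\subseteq[n],\ \theta,\theta'\in\mathcal C,\qquad \|\nabla^2 f_i(\theta)\|_2\le K\quad\text{for all } i\in[n],\ \theta\in\mathcal C .$$ Let $S_0,S_1,\dots$ be random samples of deterministic sizes $|S_t|\ge 1$, each drawn uniformly from $[n]$, with or without replacement, with $S_t$ independent of $(S_\tau)_{\tau<t}$ for every $t$. From a deterministic starting point $\hat\theta^0$ let $$\hat\theta^{t+1}=\mathcal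 P_{\mathcal C}\big(\hat\theta^t-\eta_t\mathbf Q^t\nabla f(\hat\theta^t)\big),\qquad \mathcal P_{\mathcal C}(x)\in\operatorname{argmin}_{z\in\mathcal C}\|x-z\|_2,$$ where the minimum is assumed to be attained at every step (automatic if $\mathcal C$ is closed), with random step sizes $\eta_t\ge0$ and random matrices $\mathbf Q^t\in\mathbb{R}^{p\times p}$. Fix $t$ such that $\hat\theta^t\in\mathcal C$ (automatic for $t\ge1$), and suppose that for every $\tau<t$, $\eta_\tau$ and $\mathbf Q^\tau$ are functions of $S_0,\dots,S_\tau$ (while $\eta_t$ and $\mathbf Q^t$ may be any random variables, in particular any functions of $S_0,\dots,S_t$). Then, with probability at least $1-2/p$, $$\|\hat\theta^{t+1}-\theta_*\|_2\le\xi_1^t\,\|\hat\theta^t-\theta_*\|_2+\xi_2^t\,\|\hat\theta^t-\theta_*\|_2^2,$$ where $$\xi_1^t=\big\|I-\eta_t\mathbf Q^t\mathbf H_{S_t}(\hat\theta^t)\big\|_2+\eta_t\,cK\,\|\mathbf Q^t\|_2\sqrt{\frac{\log p}{|S_t|}},\qquad \xi_2^t=\eta_t\,\frac{M_n}{2}\,\|\mathbf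 Q^t\|_2 .$$ -/

import Mathlib

open MeasureTheory ProbabilityTheory

noncomputable section

/-- Euclidean space of dimension `p`. Its continuous linear endomorphisms are the real `p × p`
matrices, and their operator norm is the spectral norm. -/
abbrev Euc (p : ℕ) : Type := EuclideanSpace ℝ (Fin p)

/-- The Hessian of `g` at `θ`, as the linear operator that is the derivative of the gradient. -/
def hessian {p : ℕ} (g : Euc p → ℝ) (θ : Euc p) : Euc p →L[ℝ] Euc p :=
  fderiv ℝ (gradient g) θ

/-- The objective: the average of the functions `f i`. -/
def objective {n p : ℕ} (f : Fin n → Euc p → ℝ) (θ : Euc p) : ℝ :=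
  (1 / (n : ℝ)) * ∑ i, f i θ

/-- The averaged Hessian `H_s(θ)` over a collection `s` of indices, counted with multiplicity
(an index set `S` is the multiset `S.val`). -/
def avgHessian {n p : ℕ} (f : Fin n → Euc p → ℝ) (s : Multiset (Fin n)) (θ : Euc p) :
    Euc p →L[ℝ] Euc p :=
  (1 / (Multiset.card s : ℝ)) • (s.map fun i => hessian (f i) θ).sum

/-- `y` is a Euclidean projection of `x` onto `C`: a point of `C` nearest to `x`. -/
def IsProjection {p : ℕ} (C : Set (Euc p)) (x y : Euc p) : Prop :=
  y ∈ C ∧ ∀ z ∈ C, ‖x - y‖ ≤ ‖x - z‖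

/-- `S` has the law of `m` independent uniform draws from `[n]` (sampling with replacement);
the sample is recorded as a multiset: of the `n ^ m` equally likely sequences of draws,
count those whose multiset of values is `s`. -/
def UniformWithReplacement {Ω : Type*} [MeasurableSpace Ω] (μ : Measure Ω) {n : ℕ} (m : ℕ)
    (S : Ω → Multiset (Fin n)) : Prop :=
  ∀ s : Multiset (Fin n), μ.real {ω | S ω = s} =
    (Nat.card {x : Fin m → Fin n // Multiset.map x Finset.univ.val = s} : ℝ) / (n : ℝ) ^ m

/-- `S` is a uniformly distributed `m`-element subset of `[n]` (sampling without replacement). -/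
def UniformWithoutReplacement {Ω : Type*} [MeasurableSpace Ω] (μ : Measure Ω) {n : ℕ} (m : ℕ)
    (S : Ω → Multiset (Fin n)) : Prop :=
  m ≤ n ∧ ∀ s : Multiset (Fin n), μ.real {ω | S ω = s} =
    if s.Nodup ∧ Multiset.card s = m then 1 / (n.choose m : ℝ) else 0

/-- The σ-algebra generated by the samples drawn before time `t`, that is by `S τ`, `τ < t`. -/
abbrev pastSamples {Ω : Type*} {n : ℕ} (S : ℕ → Ω → Multiset (Fin n)) (t : ℕ) :
    MeasurableSpace Ω :=
  ⨆ τ : ℕ, ⨆ _ : τ < t, MeasurableSpace.comap (S τ) ⊤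

/-- Independent sub-sampling: at each time `t` the sample `S t`, of size `m t ≥ 1`, is drawn
uniformly from `[n]`, with or without replacement, independently of the earlier samples. -/
structure IndependentSubsampling {Ω : Type*} [MeasurableSpace Ω] (μ : Measure Ω) {n : ℕ}
    (m : ℕ → ℕ) (S : ℕ → Ω → Multiset (Fin n)) : Prop where
  size_pos : ∀ t, 0 < m t
  measurable : ∀ t, Measurable[_, ⊤] (S t)
  uniform : ∀ t, UniformWithReplacement μ (m t) (S t) ∨ UniformWithoutReplacement μ (m t) (S t)
  indep : ∀ t, Indep (MeasurableSpace.comap (S t) ⊤) (pastSamples S t) μ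

/-- Lipschitz continuity of the averaged Hessians on `C`, with a constant `M k` that depends only
on the size `k` of the index set. -/
def LipschitzHessians {n p : ℕ} (f : Fin n → Euc p → ℝ) (C : Set (Euc p)) (M : ℕ → ℝ) : Prop :=
  ∀ T : Finset (Fin n), T.Nonempty → ∀ θ ∈ C, ∀ θ' ∈ C,
    ‖avgHessian f T.val θ - avgHessian f T.val θ'‖ ≤ M T.card * ‖θ - θ'‖

/-- The Hessians of the functions `f i` are bounded by `K` on `C`. -/
def BoundedHessians {n p : ℕ} (f : Fin n → Euc p → ℝ) (C : Set (Euc p)) (K : ℝ) : Prop :=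
  ∀ i, ∀ θ ∈ C, ‖hessian (f i) θ‖ ≤ K

/-- The coefficient `ξ₁` of the linear term, for step size `η`, scaling matrix `Q`, sub-sampled
Hessian `H` and sample size `m`. -/
def linearCoeff {p : ℕ} (c K : ℝ) (η : ℝ) (Q H : Euc p →L[ℝ] Euc p) (m : ℕ) : ℝ :=
  ‖ContinuousLinearMap.id ℝ (Euc p) - η • (Q ∘L H)‖ +
    η * (c * K) * ‖Q‖ * √(Real.log (p : ℝ) / (m : ℝ))

/-- The coefficient `ξ₂` of the quadratic term, for step size `η`, scaling matrix `Q` and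
Lipschitz constant `L` of the full Hessian. -/
def quadraticCoeff {p : ℕ} (L : ℝ) (η : ℝ) (Q : Euc p →L[ℝ] Euc p) : ℝ :=
  η * (L / 2) * ‖Q‖

end

/-! The deterministic half compares the step with `θstar`, which is its own projection. Projection
onto a convex set is nonexpansive, so with d = θ - θstar, g the gradient at θ, F the full Hessian
and H the sub-sampled one, it suffices to bound d - ηQg = (I - ηQH)d + ηQ(H - F)d - ηQ(g - Fd). The
gradient vanishes at `θstar`, so Taylor's formula bounds g - Fd by (M n / 2)‖d‖². What remains is ‖H
- F‖ (`norm_projected_step_sub_le`).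

The probabilistic half shows ‖H - F‖ ≤ 6K√(log p / m) outside an event of probability 1/p. It uses
trace moments and exchangeable pairs. Let X be the sum of centered Hessians over the sample.
Transpositions of indices preserve the uniform law on samples and satisfy ∑ (X - X') = L X.
Symmetrizing tr((X - X')X^(2k+1)) and applying a trace mean-value inequality gives E tr X^(2k+2) ≤
((2k+1)/2) V E tr X^(2k), hence E tr X^(2k) ≤ (kV)^k p. Markov's inequality with k of order log p
concludes (`card_lt_opNorm_mul_finrank_le`). The same argument covers sampling with and without
replacement.

Since θ at time t is a function of the earlier samples, of which `S t` is independent, the bound for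
fixed θ is applied on each of the countably many histories (`measure_mem_le_of_indep`). -/

noncomputable section

/-! ### Scalar power inequalities -/

theorem pow_mul_pow_add_pow_mul_pow_le (a b : ℝ) {q r k : ℕ} (h : q + r = 2 * k) :
    a ^ q * b ^ r + a ^ r * b ^ q ≤ a ^ (2 * k) + b ^ (2 * k) := by
  have h1 : a ^ q * b ^ r ≤ |a| ^ q * |b| ^ r := by
    rw [← abs_pow, ← abs_pow, ← abs_mul]; exact le_abs_self _
  have h2 : a ^ r * b ^ q ≤ |a| ^ r * |b| ^ q := by
    rw [← abs_pow, ← abs_pow, ← abs_mul]; exact le_abs_self _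
  have h3 : 0 ≤ (|a| ^ q - |b| ^ q) * (|a| ^ r - |b| ^ r) := by
    rcases le_total |a| |b| with hab | hab
    · exact mul_nonneg_of_nonpos_of_nonpos
        (sub_nonpos.2 (pow_le_pow_left₀ (abs_nonneg a) hab q))
        (sub_nonpos.2 (pow_le_pow_left₀ (abs_nonneg a) hab r))
    · exact mul_nonneg (sub_nonneg.2 (pow_le_pow_left₀ (abs_nonneg b) hab q))
        (sub_nonneg.2 (pow_le_pow_left₀ (abs_nonneg b) hab r))
  have h4 : a ^ (2 * k) = |a| ^ q * |a| ^ r := by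
    rw [← pow_add, h, (even_two_mul k).pow_abs]
  have h5 : b ^ (2 * k) = |b| ^ q * |b| ^ r := by
    rw [← pow_add, h, (even_two_mul k).pow_abs]
  rw [h4, h5]
  linarith

/-- Factor the difference of powers as (a - b) ∑ a^i b^(2k-i) and pair each term with its
reflection; each pair is at most a^(2k) + b^(2k). -/
theorem sub_mul_pow_sub_pow_le (a b : ℝ) (k : ℕ) :
    (a - b) * (a ^ (2 * k + 1) - b ^ (2 * k + 1)) ≤
      (2 * k + 1) / 2 * ((a - b) ^ 2 * (a ^ (2 * k) + b ^ (2 * k))) := by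
  have hg := geom_sum₂_mul a b (2 * k + 1)
  have hrefl : ∑ i ∈ Finset.range (2 * k + 1), a ^ i * b ^ (2 * k + 1 - 1 - i) =
      ∑ i ∈ Finset.range (2 * k + 1), a ^ (2 * k + 1 - 1 - i) * b ^ i := by
    rw [← Finset.sum_range_reflect]
    refine Finset.sum_congr rfl fun i hi => ?_
    have := Finset.mem_range.1 hi
    congr 2
    omega
  have hsum : 2 * ∑ i ∈ Finset.range (2 * k + 1), a ^ i * b ^ (2 * k + 1 - 1 - i) ≤
      (2 * k + 1) * (a ^ (2 * k) + b ^ (2 * k)) := by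
    calc 2 * ∑ i ∈ Finset.range (2 * k + 1), a ^ i * b ^ (2 * k + 1 - 1 - i)
        = ∑ i ∈ Finset.range (2 * k + 1),
            (a ^ i * b ^ (2 * k + 1 - 1 - i) + a ^ (2 * k + 1 - 1 - i) * b ^ i) := by
          rw [Finset.sum_add_distrib, ← hrefl, two_mul]
      _ ≤ ∑ i ∈ Finset.range (2 * k + 1), (a ^ (2 * k) + b ^ (2 * k)) := by
          refine Finset.sum_le_sum fun i hi => pow_mul_pow_add_pow_mul_pow_le a b ?_
          have := Finset.mem_range.1 hi
          omega
      _ = _ := by simp [mul_add]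
  rw [← hg]
  nlinarith [mul_le_mul_of_nonneg_left hsum (sq_nonneg (a - b))]

/-! ### Trace inequalities for symmetric operators -/

section OperatorTrace

variable {E : Type*} [NormedAddCommGroup E] [InnerProductSpace ℝ E]

/-- The trace of a continuous endomorphism. -/
def opTrace (E : Type*) [NormedAddCommGroup E] [InnerProductSpace ℝ E] :
    (E →L[ℝ] E) →ₗ[ℝ] ℝ :=
  (LinearMap.trace ℝ E).comp (ContinuousLinearMap.coeLM ℝ)

theorem opTrace_mul_comm (A B : E →L[ℝ] E) : opTrace E (A * B) = opTrace E (B * A) :=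
  LinearMap.trace_mul_comm ℝ (A : E →ₗ[ℝ] E) (B : E →ₗ[ℝ] E)

theorem opTrace_eq_sum_inner {ι : Type*} [Fintype ι] (u : OrthonormalBasis ι ℝ E)
    (A : E →L[ℝ] E) : opTrace E A = ∑ i, inner ℝ (u i) (A (u i)) :=
  LinearMap.trace_eq_sum_inner (A : E →ₗ[ℝ] E) u

/-- `u` is an orthonormal eigenbasis of `A` with eigenvalues `a`. -/
def IsEigenbasis {ι : Type*} [Fintype ι] (A : E →L[ℝ] E) (u : OrthonormalBasis ι ℝ E)
    (a : ι → ℝ) : Prop :=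
  ∀ i, A (u i) = a i • u i

theorem exists_isEigenbasis [FiniteDimensional ℝ E] {A : E →L[ℝ] E}
    (hA : (A : E →ₗ[ℝ] E).IsSymmetric) :
    ∃ (u : OrthonormalBasis (Fin (Module.finrank ℝ E)) ℝ E)
      (a : Fin (Module.finrank ℝ E) → ℝ), IsEigenbasis A u a :=
  ⟨hA.eigenvectorBasis rfl, hA.eigenvalues rfl, fun i => hA.apply_eigenvectorBasis rfl i⟩

variable {ι κ : Type*} [Fintype ι] [Fintype κ] {A B : E →L[ℝ] E}
  {u : OrthonormalBasis ι ℝ E} {a : ι → ℝ} {v : OrthonormalBasis κ ℝ E} {b : κ → ℝ}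

theorem IsEigenbasis.pow_apply (h : IsEigenbasis A u a) (r : ℕ) (i : ι) :
    (A ^ r) (u i) = a i ^ r • u i := by
  induction r with
  | zero => simp
  | succ r ih =>
    rw [pow_succ', mul_apply_eq_comp, ih, map_smul, h i, smul_smul, pow_succ]

theorem IsEigenbasis.opTrace_mul_pow (h : IsEigenbasis A u a) (T : E →L[ℝ] E) (r : ℕ) :
    opTrace E (T * A ^ r) = ∑ i, a i ^ r * inner ℝ (u i) (T (u i)) := by
  rw [opTrace_eq_sum_inner u]
  refine Finset.sum_congr rfl fun i _ => ?_
  rw [mul_apply_eq_comp, h.pow_apply, map_smul, inner_smul_right]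

theorem IsEigenbasis.opTrace_pow (h : IsEigenbasis A u a) (r : ℕ) :
    opTrace E (A ^ r) = ∑ i, a i ^ r := by
  have := h.opTrace_mul_pow 1 r
  simpa using this

theorem IsEigenbasis.inner_pow_apply (h : IsEigenbasis A u a) (r : ℕ) (x : E) :
    inner ℝ x ((A ^ r) x) = ∑ i, a i ^ r * inner ℝ x (u i) ^ 2 := by
  conv_lhs => rw [← u.sum_repr' x]
  rw [map_sum]
  conv_lhs => rw [u.sum_repr' x]
  rw [inner_sum]
  refine Finset.sum_congr rfl fun i _ => ?_
  rw [map_smul, h.pow_apply, inner_smul_right, inner_smul_right, real_inner_comm x (u i)]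
  ring

/-- The weights ⟨u i, v j⟩² are nonnegative and serve as a joint spectral distribution of two
operators that need not commute, so scalar inequalities in (a i, b j) lift to traces. -/
theorem IsEigenbasis.opTrace_pow_mul_pow (hA : IsEigenbasis A u a) (hB : IsEigenbasis B v b)
    (r s : ℕ) :
    opTrace E (A ^ r * B ^ s) = ∑ i, ∑ j, inner ℝ (u i) (v j) ^ 2 * (a i ^ r * b j ^ s) := by
  rw [opTrace_mul_comm, hA.opTrace_mul_pow]
  refine Finset.sum_congr rfl fun i _ => ?_
  rw [hB.inner_pow_apply, Finset.mul_sum]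
  exact Finset.sum_congr rfl fun j _ => by ring

variable [FiniteDimensional ℝ E]

/-- By cyclicity of the trace, both sides are combinations of the mixed traces tr(A^r B^s), so the
scalar inequality `sub_mul_pow_sub_pow_le` can be summed against the nonnegative weights.
Commutativity of A and B is not needed. -/
theorem opTrace_sub_mul_pow_sub_pow_le (hA : (A : E →ₗ[ℝ] E).IsSymmetric)
    (hB : (B : E →ₗ[ℝ] E).IsSymmetric) (k : ℕ) :
    opTrace E ((A - B) * (A ^ (2 * k + 1) - B ^ (2 * k + 1))) ≤
      (2 * k + 1) / 2 * (opTrace E ((A - B) ^ 2 * A ^ (2 * k)) +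
        opTrace E ((A - B) ^ 2 * B ^ (2 * k))) := by
  obtain ⟨u, a, hu⟩ := exists_isEigenbasis hA
  obtain ⟨v, b, hv⟩ := exists_isEigenbasis hB
  have key := hu.opTrace_pow_mul_pow hv
  have e1 : opTrace E ((A - B) * (A ^ (2 * k + 1) - B ^ (2 * k + 1))) =
      opTrace E (A ^ (2 * k + 2) * B ^ 0) - opTrace E (A ^ 1 * B ^ (2 * k + 1)) -
        opTrace E (A ^ (2 * k + 1) * B ^ 1) + opTrace E (A ^ 0 * B ^ (2 * k + 2)) := by
    rw [opTrace_mul_comm (A ^ (2 * k + 1)) (B ^ 1), ← map_sub, ← map_sub, ← map_add]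
    congr 1
    simp only [pow_zero, pow_one, mul_one, one_mul, pow_succ' _ (2 * k + 1), sub_mul, mul_sub]
    abel
  have e2 : opTrace E ((A - B) ^ 2 * A ^ (2 * k)) =
      opTrace E (A ^ (2 * k + 2) * B ^ 0) - 2 * opTrace E (A ^ (2 * k + 1) * B ^ 1) +
        opTrace E (A ^ (2 * k) * B ^ 2) := by
    have c1 : opTrace E (A * B * A ^ (2 * k)) = opTrace E (A ^ (2 * k + 1) * B ^ 1) := by
      rw [opTrace_mul_comm, ← mul_assoc, ← pow_succ, pow_one]
    have c2 : opTrace E (B * A * A ^ (2 * k)) = opTrace E (A ^ (2 * k + 1) * B ^ 1) := by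
      rw [mul_assoc, opTrace_mul_comm, ← pow_succ', pow_one]
    have c3 : opTrace E (B * B * A ^ (2 * k)) = opTrace E (A ^ (2 * k) * B ^ 2) := by
      rw [opTrace_mul_comm, ← pow_two]
    have c4 : A * A * A ^ (2 * k) = A ^ (2 * k + 2) := by
      rw [mul_assoc, ← pow_succ', ← pow_succ']
    rw [show (A - B) ^ 2 * A ^ (2 * k) = A * A * A ^ (2 * k) - A * B * A ^ (2 * k) -
      B * A * A ^ (2 * k) + B * B * A ^ (2 * k) by
        simp only [pow_two, sub_mul, mul_sub, mul_assoc]; abel, map_add, map_sub, map_sub, c1, c2,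
      c3, c4, pow_zero, mul_one]
    ring
  have e3 : opTrace E ((A - B) ^ 2 * B ^ (2 * k)) =
      opTrace E (A ^ 0 * B ^ (2 * k + 2)) - 2 * opTrace E (A ^ 1 * B ^ (2 * k + 1)) +
        opTrace E (A ^ 2 * B ^ (2 * k)) := by
    have c1 : opTrace E (A * B * B ^ (2 * k)) = opTrace E (A ^ 1 * B ^ (2 * k + 1)) := by
      rw [mul_assoc, ← pow_succ', pow_one]
    have c2 : opTrace E (B * A * B ^ (2 * k)) = opTrace E (A ^ 1 * B ^ (2 * k + 1)) := by
      rw [mul_assoc, opTrace_mul_comm, mul_assoc, ← pow_succ, pow_one]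
    have c4 : B * B * B ^ (2 * k) = B ^ (2 * k + 2) := by
      rw [mul_assoc, ← pow_succ', ← pow_succ']
    rw [show (A - B) ^ 2 * B ^ (2 * k) = A ^ 2 * B ^ (2 * k) - A * B * B ^ (2 * k) -
      B * A * B ^ (2 * k) + B * B * B ^ (2 * k) by
        simp only [pow_two, sub_mul, mul_sub, mul_assoc]; abel, map_add, map_sub, map_sub, c1, c2,
      c4, pow_zero, one_mul]
    ring
  rw [e1, e2, e3]
  simp only [key, Finset.mul_sum, ← Finset.sum_sub_distrib, ← Finset.sum_add_distrib]
  refine Finset.sum_le_sum fun i _ => Finset.sum_le_sum fun j _ => ?_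
  have := mul_le_mul_of_nonneg_left (sub_mul_pow_sub_pow_le (a i) (b j) k)
    (sq_nonneg (inner ℝ (u i) (v j)))
  refine le_trans (le_of_eq ?_) (this.trans (le_of_eq ?_)) <;> ring

theorem opTrace_pow_two_mul_nonneg (hA : (A : E →ₗ[ℝ] E).IsSymmetric) (k : ℕ) :
    0 ≤ opTrace E (A ^ (2 * k)) := by
  obtain ⟨u, a, hu⟩ := exists_isEigenbasis hA
  rw [hu.opTrace_pow]
  exact Finset.sum_nonneg fun i _ => (even_two_mul k).pow_nonneg _

/-- In an eigenbasis of A the diagonal entries of B² are ‖B (u i)‖² ≤ ‖B‖², and they multiply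
nonnegative even powers. -/
theorem opTrace_sq_mul_pow_le (hA : (A : E →ₗ[ℝ] E).IsSymmetric)
    (hB : (B : E →ₗ[ℝ] E).IsSymmetric) (k : ℕ) :
    opTrace E (B ^ 2 * A ^ (2 * k)) ≤ ‖B‖ ^ 2 * opTrace E (A ^ (2 * k)) := by
  obtain ⟨u, a, hu⟩ := exists_isEigenbasis hA
  rw [hu.opTrace_pow, hu.opTrace_mul_pow, Finset.mul_sum]
  refine Finset.sum_le_sum fun i _ => ?_
  rw [mul_comm]
  refine mul_le_mul_of_nonneg_right ?_ ((even_two_mul k).pow_nonneg _)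
  have h1 : inner ℝ (u i) ((B ^ 2) (u i)) = ‖B (u i)‖ ^ 2 := by
    rw [pow_two, mul_apply_eq_comp, ← real_inner_self_eq_norm_sq]
    exact (hB (u i) (B (u i))).symm
  rw [h1]
  refine pow_le_pow_left₀ (norm_nonneg _) ?_ 2
  have := B.le_opNorm (u i)
  rwa [u.norm_eq_one, mul_one] at this

/-- An even trace moment dominates the corresponding power of each single eigenvalue. -/
theorem opNorm_le_of_opTrace_pow_le (hA : (A : E →ₗ[ℝ] E).IsSymmetric) {s : ℝ} (hs : 0 ≤ s)
    {k : ℕ} (hk : k ≠ 0) (h : opTrace E (A ^ (2 * k)) ≤ s ^ (2 * k)) : ‖A‖ ≤ s := by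
  obtain ⟨u, a, hu⟩ := exists_isEigenbasis hA
  rw [hu.opTrace_pow] at h
  have ha : ∀ i, a i ^ 2 ≤ s ^ 2 := by
    intro i
    have h1 : a i ^ (2 * k) ≤ s ^ (2 * k) :=
      (Finset.single_le_sum (fun j _ => (even_two_mul k).pow_nonneg (a j))
        (Finset.mem_univ i)).trans h
    rw [pow_mul, pow_mul] at h1
    exact le_of_pow_le_pow_left₀ hk (sq_nonneg s) h1
  refine A.opNorm_le_bound hs fun x => ?_
  refine le_of_sq_le_sq ?_ (mul_nonneg hs (norm_nonneg x))
  have h1 : ‖A x‖ ^ 2 = inner ℝ x ((A ^ 2) x) := by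
    rw [pow_two A, mul_apply_eq_comp, ← real_inner_self_eq_norm_sq]
    exact hA x (A x)
  rw [h1, hu.inner_pow_apply, mul_pow, ← u.sum_sq_norm_inner_left x, Finset.mul_sum]
  refine Finset.sum_le_sum fun i _ => ?_
  rw [Real.norm_eq_abs, sq_abs]
  exact mul_le_mul_of_nonneg_right (ha i) (sq_nonneg _)

end OperatorTrace

/-! ### Moment method with exchangeable pairs -/

section ExchangeableMoments

variable {E : Type*} [NormedAddCommGroup E] [InnerProductSpace ℝ E] [FiniteDimensional ℝ E]
  {W I : Type*} [Fintype W] [Fintype I] {τ : I → W → W} {X : W → E →L[ℝ] E} {L V : ℝ}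

/-- One step of the moment method for a matrix-valued statistic `X` of a uniformly distributed
point of `W`, with exchangeable pairs given by the involutions `τ a`. -/
theorem sum_opTrace_pow_succ_le (hτ : ∀ a, Function.Involutive (τ a))
    (hX : ∀ w, (X w : E →ₗ[ℝ] E).IsSymmetric) (hL : 0 < L)
    (hsum : ∀ w, ∑ a, (X w - X (τ a w)) = L • X w)
    (hvar : ∀ w, ∑ a, ‖X w - X (τ a w)‖ ^ 2 ≤ L * V) (k : ℕ) :
    ∑ w, opTrace E (X w ^ (2 * (k + 1))) ≤
      (2 * k + 1) / 2 * V * ∑ w, opTrace E (X w ^ (2 * k)) := by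
  have hswap : ∀ (a : I) (g : W → W → ℝ), ∑ w, g w (τ a w) = ∑ w, g (τ a w) w := fun a g => by
    rw [← Equiv.sum_comp (hτ a).toPerm]
    simp [hτ a _]
  have hsymm : ∀ (w : W) (a : I), ((X w - X (τ a w) : E →L[ℝ] E) : E →ₗ[ℝ] E).IsSymmetric :=
    fun w a => by simpa using (hX w).sub (hX (τ a w))
  refine le_of_mul_le_mul_left ?_ hL
  calc L * ∑ w, opTrace E (X w ^ (2 * (k + 1)))
      = ∑ a, ∑ w, opTrace E ((X w - X (τ a w)) * X w ^ (2 * k + 1)) := by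
        rw [Finset.sum_comm, Finset.mul_sum]
        refine Finset.sum_congr rfl fun w _ => ?_
        rw [← map_sum, ← Finset.sum_mul, hsum w, smul_mul_assoc, map_smul, smul_eq_mul,
          ← pow_succ']
        rfl
    _ ≤ ∑ a, ∑ w, (2 * k + 1) / 2 * opTrace E ((X w - X (τ a w)) ^ 2 * X w ^ (2 * k)) := by
        refine Finset.sum_le_sum fun a _ => ?_
        -- Exchangeability: reindexing by τ a swaps the roles of w and τ a w. This antisymmetrizes
        -- the left side, and merges the two traces on the right into one.
        have h1 := hswap a fun w w' => opTrace E ((X w - X w') * X w ^ (2 * k + 1))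
        have h2 := hswap a fun w w' => (2 * k + 1) / 2 * opTrace E ((X w - X w') ^ 2 * X w ^ (2 * k))
        have h3 : ∑ w, opTrace E ((X w - X (τ a w)) *
            (X w ^ (2 * k + 1) - X (τ a w) ^ (2 * k + 1))) ≤ _ :=
          Finset.sum_le_sum fun w _ => opTrace_sub_mul_pow_sub_pow_le (hX w) (hX (τ a w)) k
        have h4 : ∑ w, opTrace E ((X w - X (τ a w)) *
            (X w ^ (2 * k + 1) - X (τ a w) ^ (2 * k + 1))) =
            ∑ w, opTrace E ((X w - X (τ a w)) * X w ^ (2 * k + 1)) +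
            ∑ w, opTrace E ((X (τ a w) - X w) * X (τ a w) ^ (2 * k + 1)) := by
          rw [← Finset.sum_add_distrib]
          refine Finset.sum_congr rfl fun w _ => ?_
          rw [← map_add]
          congr 1
          simp only [mul_sub, sub_mul]
          abel
        have h5 : ∑ w, (2 * k + 1 : ℝ) / 2 * (opTrace E ((X w - X (τ a w)) ^ 2 * X w ^ (2 * k)) +
              opTrace E ((X w - X (τ a w)) ^ 2 * X (τ a w) ^ (2 * k))) =
            ∑ w, (2 * k + 1) / 2 * opTrace E ((X w - X (τ a w)) ^ 2 * X w ^ (2 * k)) +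
            ∑ w, (2 * k + 1) / 2 * opTrace E ((X (τ a w) - X w) ^ 2 * X (τ a w) ^ (2 * k)) := by
          rw [← Finset.sum_add_distrib]
          refine Finset.sum_congr rfl fun w _ => ?_
          rw [mul_add, ← neg_sub (X w) (X (τ a w)), neg_sq]
        linarith
    _ = ∑ w, ∑ a, (2 * k + 1) / 2 * opTrace E ((X w - X (τ a w)) ^ 2 * X w ^ (2 * k)) :=
        Finset.sum_comm
    _ ≤ ∑ w, (2 * k + 1) / 2 * (L * V * opTrace E (X w ^ (2 * k))) := by
        refine Finset.sum_le_sum fun w _ => ?_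
        rw [← Finset.mul_sum]
        refine mul_le_mul_of_nonneg_left ?_ (by positivity)
        calc ∑ a, opTrace E ((X w - X (τ a w)) ^ 2 * X w ^ (2 * k))
            ≤ ∑ a, ‖X w - X (τ a w)‖ ^ 2 * opTrace E (X w ^ (2 * k)) :=
              Finset.sum_le_sum fun a _ => opTrace_sq_mul_pow_le (hX w) (hsymm w a) k
          _ ≤ L * V * opTrace E (X w ^ (2 * k)) := by
              rw [← Finset.sum_mul]
              exact mul_le_mul_of_nonneg_right (hvar w) (opTrace_pow_two_mul_nonneg (hX w) k)
    _ = L * ((2 * k + 1) / 2 * V * ∑ w, opTrace E (X w ^ (2 * k))) := by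
        rw [Finset.mul_sum, Finset.mul_sum]
        exact Finset.sum_congr rfl fun w _ => by ring

theorem sum_opTrace_pow_le (hτ : ∀ a, Function.Involutive (τ a))
    (hX : ∀ w, (X w : E →ₗ[ℝ] E).IsSymmetric) (hL : 0 < L) (hV : 0 ≤ V)
    (hsum : ∀ w, ∑ a, (X w - X (τ a w)) = L • X w)
    (hvar : ∀ w, ∑ a, ‖X w - X (τ a w)‖ ^ 2 ≤ L * V) (k : ℕ) :
    ∑ w, opTrace E (X w ^ (2 * k)) ≤
      (k * V) ^ k * (Module.finrank ℝ E * Fintype.card W) := by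
  -- The base kV is frozen while j runs up to k: every step costs (2j+1)/2 ≤ k.
  suffices h : ∀ j ≤ k, ∑ w, opTrace E (X w ^ (2 * j)) ≤
      (k * V) ^ j * (Module.finrank ℝ E * Fintype.card W) from h k le_rfl
  intro j
  induction j with
  | zero =>
    intro _
    have h1 : opTrace E 1 = Module.finrank ℝ E := LinearMap.trace_one ℝ E
    simp [h1, mul_comm]
  | succ j ih =>
    intro hj
    have hj' : ((j : ℝ) + 1) ≤ k := by exact_mod_cast hj
    calc ∑ w, opTrace E (X w ^ (2 * (j + 1)))
        ≤ (2 * j + 1) / 2 * V * ∑ w, opTrace E (X w ^ (2 * j)) :=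
          sum_opTrace_pow_succ_le hτ hX hL hsum hvar j
      _ ≤ k * V * ((k * V) ^ j * (Module.finrank ℝ E * Fintype.card W)) := by
          refine mul_le_mul ?_ (ih (by omega))
            (Finset.sum_nonneg fun w _ => opTrace_pow_two_mul_nonneg (hX w) j) (by positivity)
          exact mul_le_mul_of_nonneg_right (by linarith) hV
      _ = _ := by ring

/-- Markov's inequality for the counting measure on `W`. -/
theorem card_lt_opNorm_mul_pow_le (hX : ∀ w, (X w : E →ₗ[ℝ] E).IsSymmetric) {s : ℝ} (hs : 0 ≤ s)
    {k : ℕ} (hk : k ≠ 0) :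
    Nat.card {w // s < ‖X w‖} * s ^ (2 * k) ≤ ∑ w, opTrace E (X w ^ (2 * k)) := by
  classical
  rw [Nat.card_eq_fintype_card, Fintype.card_subtype]
  calc ((Finset.univ.filter fun w => s < ‖X w‖).card : ℝ) * s ^ (2 * k)
      = ∑ w ∈ Finset.univ.filter (fun w => s < ‖X w‖), s ^ (2 * k) := by simp
    _ ≤ ∑ w ∈ Finset.univ.filter (fun w => s < ‖X w‖), opTrace E (X w ^ (2 * k)) := by
        refine Finset.sum_le_sum fun w hw => ?_
        by_contra! h
        exact (Finset.mem_filter.1 hw).2.not_ge (opNorm_le_of_opTrace_pow_le (hX w) hs hk h.le)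
    _ ≤ _ := Finset.sum_le_sum_of_subset_of_nonneg (Finset.filter_subset _ _)
        fun w _ _ => opTrace_pow_two_mul_nonneg (hX w) k

/-- A Hoeffding-type tail bound for a symmetric-matrix-valued statistic of exchangeable data. -/
theorem card_lt_opNorm_mul_finrank_le (hτ : ∀ a, Function.Involutive (τ a))
    (hX : ∀ w, (X w : E →ₗ[ℝ] E).IsSymmetric) (hL : 0 < L) (hV : 0 ≤ V)
    (hsum : ∀ w, ∑ a, (X w - X (τ a w)) = L • X w)
    (hvar : ∀ w, ∑ a, ‖X w - X (τ a w)‖ ^ 2 ≤ L * V) (hd : 3 ≤ Module.finrank ℝ E) :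
    (Nat.card {w // √(9 * V * Real.log (Module.finrank ℝ E)) < ‖X w‖} : ℝ) * Module.finrank ℝ E ≤
      Fintype.card W := by
  set d : ℝ := (Module.finrank ℝ E : ℝ) with hd_def
  have hd3 : (3 : ℝ) ≤ d := by rw [hd_def]; exact_mod_cast hd
  have he3 : Real.exp 1 ≤ 3 := by linarith [Real.exp_one_lt_d9]
  have hlog : 1 ≤ Real.log d := by
    rw [Real.le_log_iff_exp_le (by linarith)]
    linarith
  set s := √(9 * V * Real.log d)
  -- V = 0 is separate because the main case cancels (3V log d)^k; here the second moment already
  -- forces X = 0.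
  rcases hV.eq_or_lt with rfl | hVpos
  · have h1 := sum_opTrace_pow_le hτ hX hL le_rfl hsum hvar 1
    have h2 : ∀ w, ‖X w‖ ≤ 0 := fun w => by
      refine opNorm_le_of_opTrace_pow_le (hX w) le_rfl one_ne_zero ?_
      refine (Finset.single_le_sum (fun w _ => opTrace_pow_two_mul_nonneg (hX w) 1)
        (Finset.mem_univ w)).trans (h1.trans (by simp))
    have h3 : IsEmpty {w // s < ‖X w‖} :=
      ⟨fun w => (w.2.trans_le (h2 w)).not_ge (Real.sqrt_nonneg _)⟩
    simp
  -- With k ≥ 2 log d, 3^k ≥ e^k ≥ d², which absorbs the dimension factor and leaves 1/d. As log d ≥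
  -- 1, also k ≤ 3 log d, so (kV/s²)^k ≤ 3^(-k).
  · set k := ⌈2 * Real.log d⌉₊
    have hk1 : 2 * Real.log d ≤ k := Nat.le_ceil _
    have hk2 : (k : ℝ) ≤ 3 * Real.log d := by
      have := (Nat.ceil_lt_add_one (show 0 ≤ 2 * Real.log d by linarith)).le
      linarith
    have hk0 : k ≠ 0 := by
      intro h
      rw [h, Nat.cast_zero] at hk1
      linarith
    have hs2 : s ^ (2 * k) = 3 ^ k * (3 * V * Real.log d) ^ k := by
      rw [pow_mul, Real.sq_sqrt (by positivity), ← mul_pow]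
      ring
    have h1 := (card_lt_opNorm_mul_pow_le hX (s := s) (Real.sqrt_nonneg _) hk0).trans
      (sum_opTrace_pow_le hτ hX hL hV hsum hvar k)
    rw [hs2] at h1
    have h2 : ((k : ℝ) * V) ^ k ≤ (3 * V * Real.log d) ^ k :=
      pow_le_pow_left₀ (by positivity) (by nlinarith) k
    have hpos : 0 < (3 * V * Real.log d) ^ k := by positivity
    have h3 : (Nat.card {w // s < ‖X w‖} : ℝ) * 3 ^ k ≤ d * Fintype.card W := by
      refine le_of_mul_le_mul_right ?_ hpos
      have := mul_le_mul_of_nonneg_right h2 (show 0 ≤ d * Fintype.card W by positivity)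
      linarith
    have h4 : d ^ 2 ≤ 3 ^ k := by
      calc d ^ 2 = Real.exp (2 * Real.log d) := by
            rw [two_mul, Real.exp_add, Real.exp_log (by linarith), sq]
        _ ≤ Real.exp k := Real.exp_le_exp.2 hk1
        _ = Real.exp 1 ^ k := by rw [← Real.exp_nat_mul, mul_one]
        _ ≤ 3 ^ k := pow_le_pow_left₀ (Real.exp_pos _).le he3 k
    refine le_of_mul_le_mul_left ?_ (show 0 < d by linarith)
    have := mul_le_mul_of_nonneg_left h4 (Nat.cast_nonneg (α := ℝ) (Nat.card {w // s < ‖X w‖}))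
    linarith

end ExchangeableMoments

/-! ### Exchangeable pairs for the two sampling schemes -/

section Sampling

variable {E : Type*} [NormedAddCommGroup E] [InnerProductSpace ℝ E] {n : ℕ}

theorem sub_apply_swap {G : Type*} [AddCommGroup G] (Z : Fin n → G) (i j a : Fin n) :
    Z a - Z (Equiv.swap i j a) =
      (if a = i then Z i - Z j else 0) + (if a = j then Z j - Z i else 0) := by
  rw [Equiv.swap_apply_def]
  split_ifs <;> simp_all

/-- Only ordered pairs containing a move it; each of the two positions contributes n Z a - ∑ Z, and
Z has sum zero. This supplies the factor L = 2n. -/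
theorem sum_sub_apply_swap {G : Type*} [AddCommGroup G] [Module ℝ G] {Z : Fin n → G}
    (hZ : ∑ i, Z i = 0) (a : Fin n) :
    ∑ q : Fin n × Fin n, (Z a - Z (Equiv.swap q.1 q.2 a)) = (2 * n : ℝ) • Z a := by
  simp only [sub_apply_swap, Fintype.sum_prod_type, Finset.sum_add_distrib]
  rw [Finset.sum_comm]
  simp only [Finset.sum_ite_eq, Finset.mem_univ, if_true, Finset.sum_sub_distrib, hZ, sub_zero,
    Finset.sum_const, Finset.card_univ, Fintype.card_fin]
  rw [mul_smul, two_smul, Nat.cast_smul_eq_nsmul]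

/-- When both conditions hold the two terms cancel, so no cross term appears in the square. -/
theorem norm_ite_add_ite_sq_le {G : Type*} [NormedAddCommGroup G] {x : G} {B : ℝ} (hx : ‖x‖ ≤ B)
    (P R : Prop) [Decidable P] [Decidable R] :
    ‖(if P then x else 0) + (if R then -x else 0)‖ ^ 2 ≤
      (if P then B ^ 2 else 0) + (if R then B ^ 2 else 0) := by
  have h : ‖x‖ ^ 2 ≤ B ^ 2 := pow_le_pow_left₀ (norm_nonneg _) hx 2
  have h' := sq_nonneg B
  split_ifs <;> simp <;> linarith

/-- The deviations `Y i - avg Y` summed over a sample `s`. -/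
def sampleDeviation (Y : Fin n → E →L[ℝ] E) (s : Multiset (Fin n)) : E →L[ℝ] E :=
  (s.map fun i => Y i - (1 / (n : ℝ)) • ∑ j, Y j).sum

theorem sum_sub_average_eq_zero {G : Type*} [AddCommGroup G] [Module ℝ G] (hn : 0 < n)
    (Y : Fin n → G) : ∑ i, (Y i - (1 / (n : ℝ)) • ∑ j, Y j) = 0 := by
  have : (n : ℝ) ≠ 0 := by positivity
  rw [Finset.sum_sub_distrib, Finset.sum_const, Finset.card_univ, Fintype.card_fin,
    ← Nat.cast_smul_eq_nsmul ℝ, smul_smul, mul_one_div_cancel this, one_smul, sub_self]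

theorem sampleDeviation_eq (Y : Fin n → E →L[ℝ] E) (s : Multiset (Fin n)) :
    sampleDeviation Y s =
      (s.map Y).sum - (Multiset.card s : ℝ) • ((1 / (n : ℝ)) • ∑ j, Y j) := by
  rw [sampleDeviation, Multiset.sum_map_sub, Multiset.map_const', Multiset.sum_replicate,
    Nat.cast_smul_eq_nsmul]

theorem isSymmetric_sum {ι : Type*} (s : Finset ι) {Z : ι → E →L[ℝ] E}
    (hZ : ∀ i ∈ s, (Z i : E →ₗ[ℝ] E).IsSymmetric) :
    ((∑ i ∈ s, Z i : E →L[ℝ] E) : E →ₗ[ℝ] E).IsSymmetric := by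
  intro x y
  simp only [ContinuousLinearMap.coe_coe, sum_apply, sum_inner, inner_sum]
  exact Finset.sum_congr rfl fun i hi => hZ i hi x y

theorem isSymmetric_sub_average {Y : Fin n → E →L[ℝ] E}
    (hY : ∀ i, (Y i : E →ₗ[ℝ] E).IsSymmetric) (i : Fin n) :
    ((Y i - (1 / (n : ℝ)) • ∑ j, Y j : E →L[ℝ] E) : E →ₗ[ℝ] E).IsSymmetric := by
  have h := isSymmetric_sum Finset.univ fun i _ => hY i
  intro x y
  have h1 := hY i x y
  have h2 := h x y
  simp only [ContinuousLinearMap.coe_coe] at h1 h2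
  simp only [ContinuousLinearMap.coe_coe, sub_apply,
    smul_apply, inner_sub_left, inner_sub_right, real_inner_smul_left,
    real_inner_smul_right, h1, h2]

theorem norm_sub_average_sub_le {Y : Fin n → E →L[ℝ] E} {K : ℝ} (hK : ∀ i, ‖Y i‖ ≤ K)
    (i j : Fin n) :
    ‖(Y i - (1 / (n : ℝ)) • ∑ l, Y l) - (Y j - (1 / (n : ℝ)) • ∑ l, Y l)‖ ≤ 2 * K := by
  rw [sub_sub_sub_cancel_right]
  linarith [norm_sub_le (Y i) (Y j), hK i, hK j]

variable [FiniteDimensional ℝ E] {Y : Fin n → E →L[ℝ] E} {K : ℝ}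

theorem card_sampleDeviation_withReplacement (hn : 0 < n)
    (hY : ∀ i, (Y i : E →ₗ[ℝ] E).IsSymmetric) (hK : ∀ i, ‖Y i‖ ≤ K) (m : ℕ)
    (hd : 3 ≤ Module.finrank ℝ E) :
    (Nat.card {x : Fin m → Fin n // √(9 * (m * (2 * K) ^ 2) * Real.log (Module.finrank ℝ E)) <
        ‖sampleDeviation Y (Multiset.map x Finset.univ.val)‖} : ℝ) * Module.finrank ℝ E ≤
      Fintype.card (Fin m → Fin n) := by
  set Z : Fin n → E →L[ℝ] E := fun i => Y i - (1 / (n : ℝ)) • ∑ j, Y j with hZ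
  have hX : ∀ x : Fin m → Fin n,
      sampleDeviation Y (Multiset.map x Finset.univ.val) = ∑ l, Z (x l) := fun x => by
    rw [sampleDeviation, Multiset.map_map]
    rfl
  have hZsum : ∑ i, Z i = 0 := sum_sub_average_eq_zero hn Y
  -- A move transposes two values in one draw, so the other draws cancel in the difference.
  let τ : Fin m × (Fin n × Fin n) → (Fin m → Fin n) → (Fin m → Fin n) :=
    fun a x => Function.update x a.1 (Equiv.swap a.2.1 a.2.2 (x a.1))
  have hdiff : ∀ (x : Fin m → Fin n) a, ∑ l, Z (x l) - ∑ l, Z (τ a x l) =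
      Z (x a.1) - Z (Equiv.swap a.2.1 a.2.2 (x a.1)) := fun x a => by
    rw [← Finset.sum_sub_distrib, Finset.sum_eq_single a.1]
    · simp [τ]
    · intro l _ hl
      simp [τ, hl]
    · simp
  refine card_lt_opNorm_mul_finrank_le (τ := τ) (L := 2 * n) ?_ ?_ (by positivity) (by positivity)
    ?_ ?_ hd
  · intro a x
    ext l
    by_cases h : l = a.1
    · subst h
      simp [τ]
    · simp [τ, h]
  · intro x
    rw [hX]
    exact isSymmetric_sum _ fun l _ => isSymmetric_sub_average hY _
  · intro x
    simp only [hX, hdiff]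
    rw [Fintype.sum_prod_type, Finset.smul_sum]
    exact Finset.sum_congr rfl fun l _ => sum_sub_apply_swap hZsum (x l)
  · intro x
    simp only [hX, hdiff]
    calc ∑ a : Fin m × (Fin n × Fin n), ‖Z (x a.1) - Z (Equiv.swap a.2.1 a.2.2 (x a.1))‖ ^ 2
        ≤ ∑ a : Fin m × (Fin n × Fin n), ((if x a.1 = a.2.1 then (2 * K) ^ 2 else 0) +
            (if x a.1 = a.2.2 then (2 * K) ^ 2 else 0)) := by
          refine Finset.sum_le_sum fun a _ => ?_
          rw [sub_apply_swap, ← neg_sub (Z a.2.1) (Z a.2.2)]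
          exact norm_ite_add_ite_sq_le (norm_sub_average_sub_le hK _ _) _ _
      _ = 2 * n * (m * (2 * K) ^ 2) := by
          have h2 : ∀ l : Fin m, ∑ a : Fin n × Fin n, (if x l = a.1 then (2 * K) ^ 2 else 0) =
              n * (2 * K) ^ 2 := fun l =>
            (Fintype.sum_prod_type_right' fun i _ => if x l = i then (2 * K) ^ 2 else 0).trans
              (by simp)
          have h3 : ∀ l : Fin m, ∑ a : Fin n × Fin n, (if x l = a.2 then (2 * K) ^ 2 else 0) =
              n * (2 * K) ^ 2 := fun l =>
            (Fintype.sum_prod_type' fun _ i => if x l = i then (2 * K) ^ 2 else 0).trans (by simp)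
          have h4 := Fintype.sum_prod_type' fun (l : Fin m) (a : Fin n × Fin n) =>
            (if x l = a.1 then (2 * K) ^ 2 else 0) + (if x l = a.2 then (2 * K) ^ 2 else 0)
          simp only [Finset.sum_add_distrib, h2, h3] at h4
          rw [Finset.sum_add_distrib, h4, Finset.sum_const, Finset.card_univ, Fintype.card_fin,
            nsmul_eq_mul]
          ring
      _ ≤ _ := le_rfl

theorem card_sampleDeviation_withoutReplacement (hn : 0 < n)
    (hY : ∀ i, (Y i : E →ₗ[ℝ] E).IsSymmetric) (hK : ∀ i, ‖Y i‖ ≤ K) (m : ℕ)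
    (hd : 3 ≤ Module.finrank ℝ E) :
    (Nat.card {A : {A : Finset (Fin n) // A.card = m} //
        √(9 * (m * (2 * K) ^ 2) * Real.log (Module.finrank ℝ E)) <
        ‖sampleDeviation Y A.1.val‖} : ℝ) * Module.finrank ℝ E ≤
      Fintype.card {A : Finset (Fin n) // A.card = m} := by
  set Z : Fin n → E →L[ℝ] E := fun i => Y i - (1 / (n : ℝ)) • ∑ j, Y j with hZ
  have hX : ∀ A : Finset (Fin n), sampleDeviation Y A.val = ∑ i ∈ A, Z i := fun A => rfl
  have hZsum : ∑ i, Z i = 0 := sum_sub_average_eq_zero hn Y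
  -- A move applies a transposition to the whole subset; the sum changes only if exactly one of the
  -- two indices lies in it.
  let τ : Fin n × Fin n → {A : Finset (Fin n) // A.card = m} →
      {A : Finset (Fin n) // A.card = m} :=
    fun a A => ⟨A.1.map (Equiv.swap a.1 a.2).toEmbedding, by rw [Finset.card_map, A.2]⟩
  have hdiff : ∀ A a, ∑ i ∈ A.1, Z i - ∑ i ∈ (τ a A).1, Z i =
      ∑ i ∈ A.1, (Z i - Z (Equiv.swap a.1 a.2 i)) := fun A a => by
    simp only [τ, Finset.sum_map, Finset.sum_sub_distrib]
    rfl
  refine card_lt_opNorm_mul_finrank_le (τ := τ) (L := 2 * n) ?_ ?_ (by positivity) (by positivity)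
    ?_ ?_ hd
  · intro a A
    refine Subtype.ext ?_
    ext i
    simp [τ]
  · intro A
    rw [hX]
    exact isSymmetric_sum _ fun l _ => isSymmetric_sub_average hY _
  · intro A
    simp only [hX, hdiff]
    rw [Finset.sum_comm, Finset.smul_sum]
    exact Finset.sum_congr rfl fun l _ => sum_sub_apply_swap hZsum l
  · intro A
    simp only [hX, hdiff]
    calc ∑ a : Fin n × Fin n, ‖∑ i ∈ A.1, (Z i - Z (Equiv.swap a.1 a.2 i))‖ ^ 2
        ≤ ∑ a : Fin n × Fin n, ((if a.1 ∈ A.1 then (2 * K) ^ 2 else 0) +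
            (if a.2 ∈ A.1 then (2 * K) ^ 2 else 0)) := by
          refine Finset.sum_le_sum fun a _ => ?_
          simp only [sub_apply_swap, Finset.sum_add_distrib, Finset.sum_ite_eq']
          rw [← neg_sub (Z a.1) (Z a.2)]
          exact norm_ite_add_ite_sq_le (norm_sub_average_sub_le hK _ _) _ _
      _ = 2 * n * (m * (2 * K) ^ 2) := by
          have h1 : ∑ i : Fin n, (if i ∈ A.1 then (2 * K) ^ 2 else 0) = m * (2 * K) ^ 2 := by
            rw [Finset.sum_ite_mem, Finset.univ_inter, Finset.sum_const, A.2, nsmul_eq_mul]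
          have h2 : ∑ a : Fin n × Fin n, (if a.1 ∈ A.1 then (2 * K) ^ 2 else 0) =
              n * (m * (2 * K) ^ 2) :=
            (Fintype.sum_prod_type_right' fun i _ => if i ∈ A.1 then (2 * K) ^ 2 else 0).trans
              (by rw [h1, Finset.sum_const, Finset.card_univ, Fintype.card_fin, nsmul_eq_mul])
          have h3 : ∑ a : Fin n × Fin n, (if a.2 ∈ A.1 then (2 * K) ^ 2 else 0) =
              n * (m * (2 * K) ^ 2) :=
            (Fintype.sum_prod_type' fun _ i => if i ∈ A.1 then (2 * K) ^ 2 else 0).trans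
              (by rw [h1, Finset.sum_const, Finset.card_univ, Fintype.card_fin, nsmul_eq_mul])
          rw [Finset.sum_add_distrib, h2, h3]
          ring
      _ ≤ _ := le_rfl

end Sampling

/-! ### From counting to probability -/

section Laws

variable {Ω : Type*} [MeasurableSpace Ω] {μ : Measure Ω} [IsProbabilityMeasure μ]

/-- If `S` has the law of `T` under the uniform distribution on `W`, its probabilities are given
by counting. -/
theorem measureReal_mem_mul_card_le {α W : Type*} [Fintype W] [Nonempty W] {S : Ω → α} {T : W → α}
    (hS : Measurable[_, ⊤] S)
    (hlaw : ∀ s, μ.real {ω | S ω = s} = (Nat.card {w // T w = s} : ℝ) / Fintype.card W)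
    (B : Set α) :
    μ.real {ω | S ω ∈ B} * Fintype.card W ≤ Nat.card {w // T w ∈ B} := by
  classical
  have hW : (0 : ℝ) < Fintype.card W := by exact_mod_cast Fintype.card_pos
  have hmeas : ∀ D : Set α, MeasurableSet {ω | S ω ∈ D} := fun D =>
    hS (MeasurableSpace.measurableSet_top (s := D))
  have hfin : ∀ F : Finset α, μ.real {ω | S ω ∈ F} =
      (∑ s ∈ F, (Nat.card {w // T w = s} : ℝ)) / Fintype.card W := fun F => by
    have h1 : {ω | S ω ∈ F} = ⋃ s ∈ F, {ω | S ω = s} := by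
      ext ω
      simp
    rw [h1, measureReal_biUnion_finset, Finset.sum_div]
    · exact Finset.sum_congr rfl fun s _ => hlaw s
    · intro s _ s' _ hss
      refine Set.disjoint_left.2 fun ω h h' => hss ?_
      exact h.symm.trans h'
    · exact fun s _ => hmeas {s}
  have hcount : ∀ D : Set α, ∑ s ∈ (Finset.univ.image T).filter (· ∈ D),
      (Nat.card {w // T w = s} : ℝ) = Nat.card {w // T w ∈ D} := fun D => by
    simp only [Nat.card_eq_fintype_card, Fintype.card_subtype]
    rw [← Nat.cast_sum, Finset.card_eq_sum_card_fiberwise (f := T)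
      (t := (Finset.univ.image T).filter (· ∈ D))]
    · congr 1
      refine Finset.sum_congr rfl fun s hs => ?_
      congr 1
      ext w
      have := (Finset.mem_filter.1 hs).2
      simp only [Finset.mem_filter, Finset.mem_univ, true_and]
      constructor
      · rintro rfl
        exact ⟨this, rfl⟩
      · exact fun h => h.2
    · intro w hw
      have := (Finset.mem_filter.1 (Finset.mem_coe.1 hw)).2
      simpa using this
  -- The law is given only on points. The finitely many values of T already carry all the mass, so
  -- their complement is null and arbitrary sets B can be treated.
  have hone : μ.real {ω | S ω ∈ Finset.univ.image T} = 1 := by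
    have h2 := hcount Set.univ
    simp only [Set.mem_univ, Finset.filter_true] at h2
    rw [hfin, h2]
    simp [hW.ne']
  have hnull : μ.real {ω | S ω ∈ Finset.univ.image T}ᶜ = 0 := by
    rw [probReal_compl_eq_one_sub (s := {ω | S ω ∈ Finset.univ.image T})
      (hmeas {s | s ∈ Finset.univ.image T}), hone, sub_self]
  rw [← hcount B, ← le_div_iff₀ hW, ← hfin]
  calc μ.real {ω | S ω ∈ B}
      ≤ μ.real ({ω | S ω ∈ (Finset.univ.image T).filter (· ∈ B)} ∪
          {ω | S ω ∈ Finset.univ.image T}ᶜ) := by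
        refine measureReal_mono fun ω hω => ?_
        by_cases h : S ω ∈ Finset.univ.image T
        · exact Or.inl (Finset.mem_filter.2 ⟨h, hω⟩)
        · exact Or.inr h
    _ ≤ _ := (measureReal_union_le _ _).trans (by rw [hnull, add_zero])

variable {n : ℕ} {E : Type*} [NormedAddCommGroup E] [InnerProductSpace ℝ E]
  [FiniteDimensional ℝ E] {Y : Fin n → E →L[ℝ] E} {K : ℝ}

/-- Concentration of a uniform sample of bounded symmetric matrices, drawn with or without
replacement, around the mean of the population. -/
theorem measureReal_sampleDeviation_mul_finrank_le (hn : 0 < n)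
    (hY : ∀ i, (Y i : E →ₗ[ℝ] E).IsSymmetric) (hK : ∀ i, ‖Y i‖ ≤ K) {m : ℕ}
    (hd : 3 ≤ Module.finrank ℝ E) {S : Ω → Multiset (Fin n)} (hS : Measurable[_, ⊤] S)
    (hlaw : UniformWithReplacement μ m S ∨ UniformWithoutReplacement μ m S) :
    μ.real {ω | S ω ∈ {s | Multiset.card s = m →
      √(9 * (m * (2 * K) ^ 2) * Real.log (Module.finrank ℝ E)) < ‖sampleDeviation Y s‖}} *
        Module.finrank ℝ E ≤ 1 := by
  suffices h : ∃ (W : Type) (_ : Fintype W) (_ : Nonempty W) (T : W → Multiset (Fin n)),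
      (∀ w, Multiset.card (T w) = m) ∧
      (∀ s, μ.real {ω | S ω = s} = (Nat.card {w // T w = s} : ℝ) / Fintype.card W) ∧
      (Nat.card {w // √(9 * (m * (2 * K) ^ 2) * Real.log (Module.finrank ℝ E)) <
        ‖sampleDeviation Y (T w)‖} : ℝ) * Module.finrank ℝ E ≤ Fintype.card W by
    obtain ⟨W, _, _, T, hT, hlaw, hcard⟩ := h
    have hW : (0 : ℝ) < Fintype.card W := by exact_mod_cast Fintype.card_pos
    have h1 := measureReal_mem_mul_card_le hS hlaw {s | Multiset.card s = m →
      √(9 * (m * (2 * K) ^ 2) * Real.log (Module.finrank ℝ E)) < ‖sampleDeviation Y s‖}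
    simp only [Set.mem_ofPred_eq, hT, true_imp_iff] at h1
    refine le_of_mul_le_mul_right ?_ hW
    have := mul_le_mul_of_nonneg_right h1 (Nat.cast_nonneg (α := ℝ) (Module.finrank ℝ E))
    simp only [Set.mem_ofPred_eq]
    linarith
  rcases hlaw with hlaw | ⟨hm, hlaw⟩
  · have : NeZero n := ⟨hn.ne'⟩
    refine ⟨Fin m → Fin n, inferInstance, inferInstance, fun x => Multiset.map x Finset.univ.val,
      fun x => by simp, fun s => ?_, card_sampleDeviation_withReplacement hn hY hK m hd⟩
    rw [hlaw s]
    simp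
  · have hcard : Fintype.card {A : Finset (Fin n) // A.card = m} = n.choose m := by simp
    refine ⟨{A : Finset (Fin n) // A.card = m}, inferInstance, ?_, fun A => A.1.val, fun A => A.2,
      fun s => ?_, card_sampleDeviation_withoutReplacement hn hY hK m hd⟩
    · rw [← Fintype.card_pos_iff, hcard]
      exact Nat.choose_pos hm
    · rw [hlaw s, hcard]
      split_ifs with h
      · have : Unique {A : {A : Finset (Fin n) // A.card = m} // A.1.val = s} :=
          { default := ⟨⟨⟨s, h.1⟩, h.2⟩, rfl⟩
            uniq := fun A => Subtype.ext (Subtype.ext (Finset.val_injective A.2)) }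
        simp
      · have : IsEmpty {A : {A : Finset (Fin n) // A.card = m} // A.1.val = s} :=
          ⟨fun A => h (A.2 ▸ ⟨A.1.1.nodup, A.1.2⟩)⟩
        simp

end Laws

/-! ### Conditioning on the past samples -/

section History

variable {Ω : Type*} {n : ℕ} {S : ℕ → Ω → Multiset (Fin n)} {t : ℕ}

instance countable_multiset_fin (n : ℕ) : Countable (Multiset (Fin n)) :=
  inferInstanceAs (Countable (Quotient (List.isSetoid (Fin n))))

/-- The samples drawn before time `t`. -/
def sampleHistory (S : ℕ → Ω → Multiset (Fin n)) (t : ℕ) (ω : Ω) : Fin t → Multiset (Fin n) :=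
  fun τ => S τ ω

theorem pastSamples_le_comap_sampleHistory :
    pastSamples S t ≤ MeasurableSpace.comap (sampleHistory S t) ⊤ := by
  refine iSup₂_le fun τ hτ => ?_
  rintro _ ⟨u, -, rfl⟩
  exact ⟨{h | h ⟨τ, hτ⟩ ∈ u}, trivial, rfl⟩

theorem measurableSet_sampleHistory_eq (h : Fin t → Multiset (Fin n)) :
    MeasurableSet[pastSamples S t] {ω | sampleHistory S t ω = h} := by
  have h1 : {ω | sampleHistory S t ω = h} = ⋂ τ : Fin t, {ω | S τ ω = h τ} := by
    ext ω
    simp [sampleHistory, funext_iff]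
  rw [h1]
  refine MeasurableSet.iInter fun τ => ?_
  exact (le_iSup₂_of_le (f := fun (σ : ℕ) (_ : σ < t) => MeasurableSpace.comap (S σ) ⊤) τ.1 τ.2
    le_rfl) _ ⟨{h τ}, trivial, rfl⟩

/-- A quantity measurable with respect to the past is determined by the past samples. -/
theorem eq_of_sampleHistory_eq {β : Type*} [MeasurableSpace β] [MeasurableSingletonClass β]
    {X : Ω → β} (hX : Measurable[pastSamples S t] X) {ω ω' : Ω}
    (h : sampleHistory S t ω = sampleHistory S t ω') : X ω = X ω' := by
  obtain ⟨u, -, hu⟩ := pastSamples_le_comap_sampleHistory _ (hX (measurableSet_singleton (X ω')))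
  have h1 : ω' ∈ X ⁻¹' {X ω'} := rfl
  rw [← hu, Set.mem_preimage, ← h, ← Set.mem_preimage, hu] at h1
  exact h1

/-- A bound on the conditional probability of `S t ∈ B`, for a set `B` determined by the past
samples, holds unconditionally. -/
theorem measure_mem_le_of_indep [MeasurableSpace Ω] {μ : Measure Ω} [IsProbabilityMeasure μ]
    (hmeas : ∀ τ, Measurable[_, ⊤] (S τ))
    (hindep : Indep (MeasurableSpace.comap (S t) ⊤) (pastSamples S t) μ)
    {B : Ω → Set (Multiset (Fin n))}
    (hB : ∀ ω ω', sampleHistory S t ω = sampleHistory S t ω' → B ω = B ω')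
    {ε : ENNReal} (hε : ∀ ω, μ {ω' | S t ω' ∈ B ω} ≤ ε) :
    μ {ω | S t ω ∈ B ω} ≤ ε := by
  have hle : pastSamples S t ≤ ‹MeasurableSpace Ω› :=
    iSup₂_le fun τ _ => (hmeas τ).comap_le
  have hH : ∀ h, MeasurableSet {ω | sampleHistory S t ω = h} := fun h =>
    hle _ (measurableSet_sampleHistory_eq h)
  -- On one history B is a fixed set, so independence factors the probability. There are countably
  -- many histories, so the pieces can be summed.
  have hpiece : ∀ h, μ ({ω | S t ω ∈ B ω} ∩ {ω | sampleHistory S t ω = h}) ≤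
      ε * μ {ω | sampleHistory S t ω = h} := by
    intro h
    by_cases hne : ∃ ω₀, sampleHistory S t ω₀ = h
    · obtain ⟨ω₀, h₀⟩ := hne
      have h1 : {ω | S t ω ∈ B ω} ∩ {ω | sampleHistory S t ω = h} =
          {ω | S t ω ∈ B ω₀} ∩ {ω | sampleHistory S t ω = h} := by
        ext ω
        refine and_congr_left fun hω => ?_
        change S t ω ∈ B ω ↔ S t ω ∈ B ω₀
        rw [hB ω ω₀ (Eq.trans hω h₀.symm)]
      have h2 := (Indep_iff _ _ μ).1 hindep {ω | S t ω ∈ B ω₀} {ω | sampleHistory S t ω = h}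
        ⟨B ω₀, trivial, rfl⟩ (measurableSet_sampleHistory_eq h)
      rw [h1, h2]
      gcongr
      exact hε ω₀
    · have h1 : {ω | sampleHistory S t ω = h} = ∅ :=
        Set.eq_empty_of_forall_notMem fun ω hω => hne ⟨ω, hω⟩
      simp [h1]
  have hdisj : Pairwise (Function.onFun Disjoint fun h => {ω | sampleHistory S t ω = h}) :=
    fun h h' hh => Set.disjoint_left.2 fun ω h1 h2 => hh (Eq.trans (Eq.symm h1) h2)
  calc μ {ω | S t ω ∈ B ω}
      ≤ μ (⋃ h, {ω | S t ω ∈ B ω} ∩ {ω | sampleHistory S t ω = h}) :=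
        measure_mono fun ω hω => Set.mem_iUnion.2 ⟨sampleHistory S t ω, hω, rfl⟩
    _ ≤ ∑' h, μ ({ω | S t ω ∈ B ω} ∩ {ω | sampleHistory S t ω = h}) := measure_iUnion_le _
    _ ≤ ∑' h, ε * μ {ω | sampleHistory S t ω = h} := ENNReal.tsum_le_tsum hpiece
    _ = ε * μ (⋃ h, {ω | sampleHistory S t ω = h}) := by
        rw [ENNReal.tsum_mul_left, measure_iUnion hdisj hH]
    _ ≤ ε * 1 := by
        gcongr
        exact prob_le_one
    _ = ε := mul_one ε

end History

/-! ### Projection onto a convex set -/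

section Projection

variable {p : ℕ} {C : Set (Euc p)}

theorem IsProjection.inner_le_zero (hC : Convex ℝ C) {x y : Euc p} (h : IsProjection C x y)
    {z : Euc p} (hz : z ∈ C) : inner ℝ (x - y) (z - y) ≤ 0 := by
  have : Nonempty C := ⟨⟨y, h.1⟩⟩
  refine (norm_eq_iInf_iff_real_inner_le_zero hC h.1).1 ?_ z hz
  refine le_antisymm (le_ciInf fun w => h.2 w w.2) ?_
  exact ciInf_le (f := fun w : C => ‖x - w‖) ⟨0, by rintro _ ⟨w, rfl⟩; exact norm_nonneg _⟩ ⟨y, h.1⟩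

theorem IsProjection.self {z : Euc p} (hz : z ∈ C) : IsProjection C z z :=
  ⟨hz, fun w _ => by simp⟩

/-- Adding the two variational inequalities gives ‖y - y'‖² ≤ ⟨x - x', y - y'⟩; then Cauchy–Schwarz.
-/
theorem IsProjection.norm_sub_le (hC : Convex ℝ C) {x y x' y' : Euc p} (h : IsProjection C x y)
    (h' : IsProjection C x' y') : ‖y - y'‖ ≤ ‖x - x'‖ := by
  have h1 := h.inner_le_zero hC h'.1
  have h2 := h'.inner_le_zero hC h.1
  have h3 : ‖y - y'‖ * ‖y - y'‖ ≤ ‖x - x'‖ * ‖y - y'‖ := by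
    rw [← real_inner_self_eq_norm_mul_norm]
    refine le_trans ?_ (real_inner_le_norm (x - x') (y - y'))
    have h4 : inner ℝ (x - y) (y' - y) = -inner ℝ (x - y) (y - y') := by
      rw [← neg_sub y y', inner_neg_right]
    have h5 : inner ℝ (x - x') (y - y') - inner ℝ (y - y') (y - y') =
        inner ℝ (x - y) (y - y') - inner ℝ (x' - y') (y - y') := by
      rw [← inner_sub_left, ← inner_sub_left]
      congr 1
      abel
    linarith
  rcases (norm_nonneg (y - y')).eq_or_lt with h0 | h0
  · rw [← h0]
    exact norm_nonneg _
  · exact le_of_mul_le_mul_right h3 h0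

theorem IsProjection.unique (hC : Convex ℝ C) {x y y' : Euc p} (h : IsProjection C x y)
    (h' : IsProjection C x y') : y = y' := by
  have := h.norm_sub_le hC h'
  rw [sub_self, norm_zero, norm_le_zero_iff, sub_eq_zero] at this
  exact this

end Projection

/-! ### Hessians and Taylor's estimate -/

section Smoothness

variable {n p : ℕ} {f : Fin n → Euc p → ℝ}

/-- The Riesz isometry turns the derivative of the gradient into the second derivative, which is
symmetric wherever it exists; continuity of the Hessian is not needed. -/
theorem isSymmetric_hessian {g : Euc p → ℝ} (hg : Differentiable ℝ g)
    (hg' : Differentiable ℝ (gradient g)) (θ : Euc p) :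
    (hessian g θ : Euc p →ₗ[ℝ] Euc p).IsSymmetric := by
  have h1 : HasFDerivAt (fderiv ℝ g)
      ((InnerProductSpace.toDual ℝ (Euc p)).toContinuousLinearEquiv.toContinuousLinearMap ∘L
        hessian g θ) θ := by
    have h2 := (InnerProductSpace.toDual ℝ
      (Euc p)).toContinuousLinearEquiv.toContinuousLinearMap.hasFDerivAt.comp θ
        (hg' θ).hasFDerivAt
    refine h2.congr_of_eventuallyEq (Filter.Eventually.of_forall fun x => ?_)
    exact toDual_gradient.symm
  intro x y
  have h3 := second_derivative_symmetric_of_eventually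
    (Filter.Eventually.of_forall fun z => (hg z).hasFDerivAt) h1 x y
  have h4 : inner ℝ (hessian g θ x) y = inner ℝ (hessian g θ y) x := h3
  rw [real_inner_comm x] at h4
  exact h4

theorem gradient_objective (hf : ∀ i, Differentiable ℝ (f i)) :
    gradient (objective f) = fun θ => (1 / (n : ℝ)) • ∑ i, gradient (f i) θ := by
  ext1 θ
  refine HasGradientAt.gradient ?_
  rw [hasGradientAt_iff_hasFDerivAt, map_smul, map_sum]
  refine HasFDerivAt.const_mul (HasFDerivAt.fun_sum fun i _ => ?_) _
  exact (hf i θ).hasGradientAt.hasFDerivAt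

theorem hasFDerivAt_gradient_objective
    (hf : ∀ i, Differentiable ℝ (f i) ∧ Differentiable ℝ (gradient (f i))) (θ : Euc p) :
    HasFDerivAt (gradient (objective f)) ((1 / (n : ℝ)) • ∑ i, hessian (f i) θ) θ := by
  rw [gradient_objective fun i => (hf i).1]
  have h : HasFDerivAt (fun θ => ∑ i, gradient (f i) θ) (∑ i, hessian (f i) θ) θ :=
    HasFDerivAt.fun_sum fun i _ => ((hf i).2 θ).hasFDerivAt
  exact h.const_smul (1 / (n : ℝ))

theorem gradient_eq_zero_of_forall_le {g : Euc p → ℝ} {θ : Euc p} (h : ∀ θ', g θ ≤ g θ') :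
    gradient g θ = 0 := by
  have : IsLocalMin g θ := Filter.Eventually.of_forall h
  rw [gradient, this.fderiv_eq_zero, map_zero]

/-- The first-order Taylor estimate for a map whose derivative is Lipschitz on a convex set. -/
theorem norm_sub_sub_le_of_lipschitz_deriv {E F : Type*} [NormedAddCommGroup E] [NormedSpace ℝ E]
    [NormedAddCommGroup F] [NormedSpace ℝ F] {g : E → F} {H : E → E →L[ℝ] F}
    (hg : ∀ x, HasFDerivAt g (H x) x) {C : Set E} (hC : Convex ℝ C) {L : ℝ}
    (hH : ∀ x ∈ C, ∀ y ∈ C, ‖H x - H y‖ ≤ L * ‖x - y‖) {x y : E} (hx : x ∈ C) (hy : y ∈ C) :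
    ‖g x - g y - H x (x - y)‖ ≤ L / 2 * ‖x - y‖ ^ 2 := by
  set d := y - x
  have hd : ∀ s : ℝ, HasDerivAt (fun s : ℝ => g (x + s • d) - g x - s • H x d)
      (H (x + s • d) d - H x d) s := fun s => by
    have h1 : HasDerivAt (fun s : ℝ => x + s • d) d s := by
      simpa using ((hasDerivAt_id s).smul_const d).const_add x
    have h2 : HasDerivAt (fun s : ℝ => s • H x d) (H x d) s := by
      simpa using (hasDerivAt_id s).smul_const (H x d)
    exact (((hg (x + s • d)).comp_hasDerivAt s h1).sub_const (g x)).sub h2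
  have hB : ∀ s : ℝ, HasDerivAt (fun s : ℝ => L / 2 * ‖d‖ ^ 2 * s ^ 2) (L * ‖d‖ ^ 2 * s) s :=
    fun s => by
      have := (hasDerivAt_pow 2 s).const_mul (L / 2 * ‖d‖ ^ 2)
      refine this.congr_deriv ?_
      simp
      ring
  have hbound : ∀ s ∈ Set.Ico (0 : ℝ) 1, ‖H (x + s • d) d - H x d‖ ≤ L * ‖d‖ ^ 2 * s := by
    intro s hs
    have hmem : x + s • d ∈ C := hC.add_smul_sub_mem hx hy ⟨hs.1, hs.2.le⟩
    have h1 := hH _ hmem x hx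
    rw [add_sub_cancel_left, norm_smul, Real.norm_of_nonneg hs.1] at h1
    calc ‖H (x + s • d) d - H x d‖ = ‖(H (x + s • d) - H x) d‖ := rfl
      _ ≤ ‖H (x + s • d) - H x‖ * ‖d‖ := ContinuousLinearMap.le_opNorm _ _
      _ ≤ L * (s * ‖d‖) * ‖d‖ := mul_le_mul_of_nonneg_right h1 (norm_nonneg d)
      _ = L * ‖d‖ ^ 2 * s := by ring
  -- The remainder along the segment is compared with (L/2)‖d‖²s² through derivatives, which avoids
  -- integrating the Hessian.
  have key := image_norm_le_of_norm_deriv_right_le_deriv_boundary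
    (fun s _ => (hd s).continuousAt.continuousWithinAt) (fun s _ => (hd s).hasDerivWithinAt)
    (by simp) hB hbound (Set.right_mem_Icc.2 zero_le_one)
  have e : g x - g y - H x (x - y) = -(g (x + (1 : ℝ) • d) - g x - (1 : ℝ) • H x d) := by
    have e1 : x + (1 : ℝ) • d = y := by simp [d]
    have e2 : H x (x - y) = -H x d := by rw [← map_neg, neg_sub]
    rw [e1, e2, one_smul]
    abel
  rw [e, norm_neg, norm_sub_rev x y]
  simpa using key

end Smoothness

/-! ### One projected step -/

section NewtonStep

variable {n p : ℕ} {f : Fin n → Euc p → ℝ} {C : Set (Euc p)}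

theorem avgHessian_univ (f : Fin n → Euc p → ℝ) (θ : Euc p) :
    avgHessian f Finset.univ.val θ = (1 / (n : ℝ)) • ∑ i, hessian (f i) θ := by
  simp only [avgHessian, Finset.card_val, Finset.card_univ, Fintype.card_fin]
  rfl

theorem norm_avgHessian_sub_le {K : ℝ} (hK : 0 ≤ K) {s : Multiset (Fin n)} {m : ℕ} (hm : 0 < m)
    (hs : Multiset.card s = m) (θ : Euc p)
    (h : ‖sampleDeviation (fun i => hessian (f i) θ) s‖ ≤
      √(9 * (m * (2 * K) ^ 2) * Real.log p)) :
    ‖avgHessian f s θ - avgHessian f Finset.univ.val θ‖ ≤ 6 * K * √(Real.log p / m) := by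
  have hm' : (0 : ℝ) < m := by exact_mod_cast hm
  have e1 : avgHessian f s θ - avgHessian f Finset.univ.val θ =
      (1 / (m : ℝ)) • sampleDeviation (fun i => hessian (f i) θ) s := by
    rw [sampleDeviation_eq, avgHessian_univ, smul_sub, smul_smul, hs,
      one_div_mul_cancel hm'.ne', one_smul, avgHessian, hs]
  -- The constant 6 arises here as √(9 · 2²).
  have e2 : √(9 * (m * (2 * K) ^ 2) * Real.log p) = m * (6 * K * √(Real.log p / m)) := by
    rw [show 9 * (m * (2 * K) ^ 2) * Real.log p = (m * (6 * K)) ^ 2 * (Real.log p / m) by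
      field_simp; ring, Real.sqrt_mul (sq_nonneg _), Real.sqrt_sq (by positivity), mul_assoc]
  rw [e2] at h
  rw [e1, norm_smul, Real.norm_of_nonneg (by positivity), one_div, inv_mul_le_iff₀ hm']
  exact h

/-- The deterministic estimate for one projected step, in terms of the error of `H` as an
approximation of the full Hessian. -/
theorem norm_projected_step_sub_le (hn : 0 < n)
    (hf : ∀ i, Differentiable ℝ (f i) ∧ Differentiable ℝ (gradient (f i))) (hC : Convex ℝ C)
    {M : ℕ → ℝ} (hM : LipschitzHessians f C M) {θstar : Euc p}
    (hmin : ∀ θ, objective f θstar ≤ objective f θ) (hstar : θstar ∈ C) {θ θ' : Euc p}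
    (hθ : θ ∈ C) {η : ℝ} (hη : 0 ≤ η) {Q H : Euc p →L[ℝ] Euc p}
    (hθ' : IsProjection C (θ - η • Q (gradient (objective f) θ)) θ') {c K : ℝ} {m : ℕ}
    (hH : ‖H - avgHessian f Finset.univ.val θ‖ ≤ c * K * √(Real.log p / m)) :
    ‖θ' - θstar‖ ≤ linearCoeff c K η Q H m * ‖θ - θstar‖ +
      quadraticCoeff (M n) η Q * ‖θ - θstar‖ ^ 2 := by
  set F := avgHessian f Finset.univ.val θ
  set d := θ - θstar with hd
  have hLip : ∀ x ∈ C, ∀ y ∈ C, ‖(1 / (n : ℝ)) • ∑ i, hessian (f i) x -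
      (1 / (n : ℝ)) • ∑ i, hessian (f i) y‖ ≤ M n * ‖x - y‖ := by
    intro x hx y hy
    have := hM Finset.univ ⟨⟨0, hn⟩, Finset.mem_univ _⟩ x hx y hy
    rwa [avgHessian_univ, avgHessian_univ, Finset.card_univ, Fintype.card_fin] at this
  have htaylor := norm_sub_sub_le_of_lipschitz_deriv
    (fun x => hasFDerivAt_gradient_objective hf x) hC hLip hθ hstar
  rw [gradient_eq_zero_of_forall_le hmin, sub_zero, ← avgHessian_univ] at htaylor
  set g := gradient (objective f) θ
  have hdecomp : θ - η • Q g - θstar =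
      (ContinuousLinearMap.id ℝ (Euc p) - η • (Q ∘L H)) d + η • Q ((H - F) d) -
        η • Q (g - F d) := by
    have h1 : (ContinuousLinearMap.id ℝ (Euc p) - η • (Q ∘L H)) d = d - η • Q (H d) := rfl
    have h2 : (H - F) d = H d - F d := rfl
    rw [h1, h2, map_sub Q (H d), map_sub Q g, smul_sub, smul_sub]
    simp only [hd]
    abel
  calc ‖θ' - θstar‖ ≤ ‖θ - η • Q g - θstar‖ :=
        hθ'.norm_sub_le hC (IsProjection.self hstar)
    _ ≤ ‖(ContinuousLinearMap.id ℝ (Euc p) - η • (Q ∘L H)) d‖ + ‖η • Q ((H - F) d)‖ +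
        ‖η • Q (g - F d)‖ := by
        rw [hdecomp]
        exact (norm_sub_le _ _).trans (by gcongr; exact norm_add_le _ _)
    _ ≤ ‖ContinuousLinearMap.id ℝ (Euc p) - η • (Q ∘L H)‖ * ‖d‖ +
        η * (‖Q‖ * (c * K * √(Real.log p / m) * ‖d‖)) +
        η * (‖Q‖ * (M n / 2 * ‖d‖ ^ 2)) := by
        rw [norm_smul, norm_smul, Real.norm_of_nonneg hη]
        gcongr
        · exact ContinuousLinearMap.le_opNorm _ _
        · exact Q.le_opNorm_of_le (((H - F).le_opNorm d).trans (by gcongr))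
        · exact Q.le_opNorm_of_le htaylor
    _ = _ := by
        rw [linearCoeff, quadraticCoeff]
        ring

/-- The update is only a relation, but projections onto convex sets are unique, so induction
determines the iterate from the past samples. -/
theorem iterate_eq_of_sampleHistory_eq {Ω : Type*} (hC : Convex ℝ C)
    {S : ℕ → Ω → Multiset (Fin n)} {η : ℕ → Ω → ℝ} {Q : ℕ → Ω → (Euc p →L[ℝ] Euc p)}
    {θ : ℕ → Ω → Euc p} {θinit : Euc p} (hinit : ∀ ω, θ 0 ω = θinit)
    (hupdate : ∀ τ ω,
      IsProjection C (θ τ ω - η τ ω • Q τ ω (gradient (objective f) (θ τ ω))) (θ (τ + 1) ω))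
    {t : ℕ} (hη : ∀ τ < t, Measurable[pastSamples S (τ + 1)] (η τ))
    (hQ : ∀ τ < t, Measurable[pastSamples S (τ + 1)] (Q τ)) {ω ω' : Ω}
    (h : sampleHistory S t ω = sampleHistory S t ω') : θ t ω = θ t ω' := by
  suffices hle : ∀ τ ≤ t, θ τ ω = θ τ ω' from hle t le_rfl
  intro τ
  induction τ with
  | zero =>
    intro _
    rw [hinit, hinit]
  | succ τ ih =>
    intro hτ
    have hτ' : sampleHistory S (τ + 1) ω = sampleHistory S (τ + 1) ω' :=
      funext fun σ => congrFun h ⟨σ, σ.2.trans_le hτ⟩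
    have h1 := hupdate τ ω
    rw [ih (by omega), eq_of_sampleHistory_eq (hη τ hτ) hτ',
      eq_of_sampleHistory_eq (hQ τ hτ) hτ'] at h1
    exact h1.unique hC (hupdate τ ω')

end NewtonStep
end

/-! ### Assembly -/

theorem lemma1 :
    ∃ c : ℝ, 0 < c ∧
      ∀ (n p : ℕ) (_hn : 0 < n) (_hp : 0 < p)
        -- the functions, their smoothness, the constraint set and the minimizer
        (f : Fin n → Euc p → ℝ)
        (_hf : ∀ i, Differentiable ℝ (f i) ∧ Differentiable ℝ (gradient (f i)))
        (C : Set (Euc p)) (_hC : Convex ℝ C)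
        (M : ℕ → ℝ) (_hM : LipschitzHessians f C M)
        (K : ℝ) (_hK : BoundedHessians f C K)
        (θstar : Euc p) (_hmin : ∀ θ, objective f θstar ≤ objective f θ) (_hstar : θstar ∈ C)
        -- the random sub-samples
        (Ω : Type*) [MeasurableSpace Ω] (μ : Measure Ω) [IsProbabilityMeasure μ]
        (m : ℕ → ℕ) (S : ℕ → Ω → Multiset (Fin n)) (_hS : IndependentSubsampling μ m S)
        -- the step sizes, the scaling matrices and the iterates
        (η : ℕ → Ω → ℝ) (Q : ℕ → Ω → (Euc p →L[ℝ] Euc p)) (θ : ℕ → Ω → Euc p)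
        (_hη : ∀ τ ω, 0 ≤ η τ ω)
        (θinit : Euc p) (_hinit : ∀ ω, θ 0 ω = θinit)
        (_hupdate : ∀ τ ω,
          IsProjection C (θ τ ω - η τ ω • Q τ ω (gradient (objective f) (θ τ ω))) (θ (τ + 1) ω))
        (t : ℕ)
        -- up to time `t` they were formed from the samples drawn so far; at time `t` the
        -- scaling matrix and the step size are arbitrary random quantities
        (_hηpast : ∀ τ < t, Measurable[pastSamples S (τ + 1)] (η τ))
        (_hQpast : ∀ τ < t, Measurable[pastSamples S (τ + 1)] (Q τ))
        (_hηt : Measurable (η t)) (_hQt : Measurable (Q t))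
        -- automatic for `t ≥ 1`; for `t = 0` it says that the initial point is feasible
        (_hfeas : ∀ ω, θ t ω ∈ C),
        1 - 2 / (p : ℝ) ≤ μ.real {ω |
          ‖θ (t + 1) ω - θstar‖ ≤
            linearCoeff c K (η t ω) (Q t ω) (avgHessian f (S t ω) (θ t ω)) (m t)
                * ‖θ t ω - θstar‖ +
              quadraticCoeff (M n) (η t ω) (Q t ω) * ‖θ t ω - θstar‖ ^ 2} := by
  refine ⟨6, by norm_num, ?_⟩
  intro n p hn hp f hf C hC M hM K hK θstar hmin hstar Ω _ μ _ m S hS η Q θ hη θinit hinit hupdate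
    t hηpast hQpast _ _ hfeas
  have hp' : (0 : ℝ) < p := by exact_mod_cast hp
  rcases lt_or_ge p 3 with hp3 | hp3
  -- For p ≤ 2 the claimed probability is at most 0; the tail bound needs p ≥ 3 so that log p ≥ 1.
  · refine le_trans ?_ measureReal_nonneg
    have : (p : ℝ) ≤ 2 := by exact_mod_cast Nat.lt_succ_iff.1 hp3
    rw [sub_nonpos, le_div_iff₀ hp']
    linarith
  have hK0 : 0 ≤ K := (norm_nonneg _).trans (hK ⟨0, hn⟩ θstar hstar)
  have hrank : Module.finrank ℝ (Euc p) = p := by simp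
  -- Samples of the wrong size are counted as bad, so that avoiding B yields both the size and the
  -- deviation bound.
  set B : Ω → Set (Multiset (Fin n)) := fun ω => {s | Multiset.card s = m t →
    √(9 * (m t * (2 * K) ^ 2) * Real.log p) <
      ‖sampleDeviation (fun i => hessian (f i) (θ t ω)) s‖} with hB
  have hBprob : ∀ ω, μ {ω' | S t ω' ∈ B ω} ≤ ENNReal.ofReal (1 / p) := fun ω => by
    have h := measureReal_sampleDeviation_mul_finrank_le (Y := fun i => hessian (f i) (θ t ω)) hn
      (fun i => isSymmetric_hessian (hf i).1 (hf i).2 _) (fun i => hK i _ (hfeas ω))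
      (by rw [hrank]; exact hp3) (hS.measurable t) (hS.uniform t)
    rw [hrank, ← le_div_iff₀ hp'] at h
    exact (ENNReal.le_ofReal_iff_toReal_le (measure_ne_top _ _) (by positivity)).2 h
  have hbad : μ.real {ω | S t ω ∈ B ω} ≤ 1 / p := by
    refine ENNReal.toReal_le_of_le_ofReal (by positivity)
      (measure_mem_le_of_indep hS.measurable (hS.indep t) (fun ω ω' h => ?_) hBprob)
    simp only [hB, iterate_eq_of_sampleHistory_eq hC hinit hupdate hηpast hQpast h]
  -- Covering the whole space and using subadditivity avoids proving the good event measurable.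
  have hcover : (Set.univ : Set Ω) ⊆ {ω |
      ‖θ (t + 1) ω - θstar‖ ≤
        linearCoeff 6 K (η t ω) (Q t ω) (avgHessian f (S t ω) (θ t ω)) (m t) * ‖θ t ω - θstar‖ +
          quadraticCoeff (M n) (η t ω) (Q t ω) * ‖θ t ω - θstar‖ ^ 2} ∪
      {ω | S t ω ∈ B ω} := by
    intro ω _
    by_cases hω : S t ω ∈ B ω
    · exact Or.inr hω
    · left
      obtain ⟨hcard, hdev⟩ := Classical.not_imp.1 hω
      exact norm_projected_step_sub_le hn hf hC hM hmin hstar (hfeas ω) (hη t ω) (hupdate t ω)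
        (norm_avgHessian_sub_le hK0 (hS.size_pos t) hcard _ (not_lt.1 hdev))
  have htotal := (measureReal_mono (μ := μ) hcover).trans (measureReal_union_le _ _)
  rw [probReal_univ] at htotal
  have : (1 : ℝ) / p ≤ 2 / p := by gcongr; norm_num
  linarith
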